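/- Let $n \ge 0$, let $M_n$ be the space of complex $n\times n$ matrices with matrix units $\mathcal E=\{E_{ij}\}$, and let $t$ denote the transpose map on $M_n$. The standard matrix ordering of $M_n$ declares $A\in M_p(M_n)$ positive when it is positive semidefinite as a $pn\times pn$ matrix. A linear map $\Phi:V\to W$ of matrix ordered spaces is completely positive if, for every $p$, $(v_{ij})\in M_p(V)^+$ implies $(\Phi(v_{ij}))\in M_p(W)^+$; it is a complete order isomorphism if it is invertible and both $\Phi$ and $\Phi^{-1}$ are completely positive. The dual space $M_n^d$ is matrix ordered by declaring $(f_{ij})\in M_p(M_n^d)$ positive when the map $M_n\to M_p$, $X\mapsto (f_{ij}(X))$, is completely positive. Let $\mathcal B$ be a basis of $M_n$. Let $\mathcal D_{\mathcal B}:M_n\to M_n^d$ be the linear map taking each member of $\mathcal B$ to the corresponding member of the dual basis, and let $\Gamma_{\mathcal B}=\mathcal D_{\mathcal B}^{-1}$. Let $C_{\mathcal B}:M_n\to M_n$ be any linear map taking the set $\mathcal E$ onto the set $\mathcal B$. For a linear map $L$ on $M_n$ let $L^T$ be the linear map whose matrix in the basis $\mathcal E$ is the transpose of the matrix of $L$,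 and put $M_{\mathcal B}=C_{\mathcal B}C_{\mathcal B}^T$. For $C\in M_n$ let $\Phi_C(X)=CXC^*$. Then: 1. $M_{\mathcal B}=\Phi_C$ for some $C\in M_n$ if and only if $\Gamma_{\mathcal B}:M_n^d\to M_n$ is a complete order isomorphism. 2. $M_{\mathcal B}=t\circ\Phi_C$ for some $C\in M_n$ if and only if $t\circ\Gamma_{\mathcal B}:M_n^d\to M_n$ is a complete order isomorphism; and likewise $M_{\mathcal B}^T=t\circ\Phi_C$ for some $C\in M_n$ if and only if $t\circ\Gamma_{\mathcal B}$ is a complete order isomorphism. -/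

import Mathlib

open scoped ComplexOrder

namespace DualityMap

/-- The space `M_n` of `n × n` complex matrices. -/
abbrev Mat (n : ℕ) : Type := Matrix (Fin n) (Fin n) ℂ

/-- The compression `X* A X = (∑ k l, conj (X k i) • A k l • X l j)` of a `p × p` matrix `A` over
a complex vector space by a `p × q` matrix `X` of scalars. -/
def compress {V : Type*} [AddCommGroup V] [Module ℂ V] {p q : ℕ}
    (X : Matrix (Fin p) (Fin q) ℂ) (A : Matrix (Fin p) (Fin p) V) : Matrix (Fin q) (Fin q) V :=
  Matrix.of fun i j => ∑ k, ∑ l, (star (X k i) * X l j) • A k l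

/-- The direct sum `A ⊕ B` of two square matrices over a vector space. -/
def directSum {V : Type*} [AddCommGroup V] {p q : ℕ}
    (A : Matrix (Fin p) (Fin p) V) (B : Matrix (Fin q) (Fin q) V) :
    Matrix (Fin (p + q)) (Fin (p + q)) V :=
  Matrix.reindex finSumFinEquiv finSumFinEquiv (Matrix.fromBlocks A 0 0 B)

/-- A matrix ordering of a complex vector space `V`: a cone `M_p(V)⁺` of positive elements in
`M_p(V)` for each `p`, stable under direct sums and under compressions by scalar matrices. -/
structure MatrixOrdering (V : Type*) [AddCommGroup V] [Module ℂ V] where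
  pos : ∀ p : ℕ, Set (Matrix (Fin p) (Fin p) V)
  zero_mem : ∀ p, 0 ∈ pos p
  add_mem : ∀ p, ∀ A ∈ pos p, ∀ B ∈ pos p, A + B ∈ pos p
  smul_mem : ∀ p, ∀ r : ℝ, 0 ≤ r → ∀ A ∈ pos p, (r : ℂ) • A ∈ pos p
  directSum_mem : ∀ p q, ∀ A ∈ pos p, ∀ B ∈ pos q, directSum A B ∈ pos (p + q)
  compress_mem : ∀ p q, ∀ X : Matrix (Fin p) (Fin q) ℂ, ∀ A ∈ pos p, compress X A ∈ pos q

/-- `Φ : V → W` is completely positive: for every `p`, the entrywise map `Φ^{(p)}` takes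
`M_p(V)⁺` into `M_p(W)⁺`. -/
def IsCompletelyPositive {V W : Type*} [AddCommGroup V] [Module ℂ V] [AddCommGroup W]
    [Module ℂ W] (𝒪V : MatrixOrdering V) (𝒪W : MatrixOrdering W) (Φ : V →ₗ[ℂ] W) : Prop :=
  ∀ p : ℕ, ∀ A ∈ 𝒪V.pos p, A.map Φ ∈ 𝒪W.pos p

/-- `Φ : V → W` is a complete order isomorphism: it is invertible, and both `Φ` and its inverse
are completely positive. -/
def IsCompleteOrderIso {V W : Type*} [AddCommGroup V] [Module ℂ V] [AddCommGroup W]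
    [Module ℂ W] (𝒪V : MatrixOrdering V) (𝒪W : MatrixOrdering W) (Φ : V →ₗ[ℂ] W) : Prop :=
  ∃ Ψ : W →ₗ[ℂ] V, Ψ ∘ₗ Φ = LinearMap.id ∧ Φ ∘ₗ Ψ = LinearMap.id ∧
    IsCompletelyPositive 𝒪V 𝒪W Φ ∧ IsCompletelyPositive 𝒪W 𝒪V Ψ

theorem directSum_eq_compress {V : Type*} [AddCommGroup V] [Module ℂ V] {p q : ℕ}
    (A : Matrix (Fin p) (Fin p) V) (B : Matrix (Fin q) (Fin q) V) :
    directSum A B =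
      compress (Matrix.of fun k (i : Fin (p + q)) => if Fin.castAdd q k = i then (1 : ℂ) else 0) A +
      compress (Matrix.of fun k (i : Fin (p + q)) => if Fin.natAdd p k = i then (1 : ℂ) else 0)
        B := by
  ext i j
  obtain ⟨i, rfl⟩ := finSumFinEquiv.surjective i
  obtain ⟨j, rfl⟩ := finSumFinEquiv.surjective j
  have h1 : ∀ (a : Fin p) (b : Fin q), Fin.castAdd q a ≠ Fin.natAdd p b := by
    intro a b h
    have := congrArg Fin.val h
    simp only [Fin.val_castAdd, Fin.val_natAdd] at this
    omega
  have h2 : ∀ (a : Fin p) (b : Fin q), Fin.natAdd p b ≠ Fin.castAdd q a :=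
    fun a b h => h1 a b h.symm
  rcases i with i | i <;> rcases j with j | j <;>
    simp [directSum, compress, h1, h2, apply_ite star, ite_smul]

theorem comp_compress {n p q : ℕ} (X : Matrix (Fin p) (Fin q) ℂ)
    (A : Matrix (Fin p) (Fin p) (Mat n)) :
    Matrix.comp _ _ _ _ ℂ (compress X A) =
      (Matrix.kronecker X (1 : Mat n)).conjTranspose * Matrix.comp _ _ _ _ ℂ A *
        Matrix.kronecker X (1 : Mat n) := by
  ext ⟨i, a⟩ ⟨j, b⟩
  simp [compress, Matrix.mul_apply, Matrix.sum_apply, Fintype.sum_prod_type,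
    Matrix.kroneckerMap_apply, Matrix.one_apply, Finset.sum_mul, apply_ite star]
  rw [Finset.sum_comm]
  refine Finset.sum_congr rfl fun l _ => Finset.sum_congr rfl fun k _ => ?_
  ring

/-- The standard matrix ordering of `M_n`: an element of `M_p(M_n)` is positive when it is a
positive semidefinite `pn × pn` matrix. -/
def matOrdering (n : ℕ) : MatrixOrdering (Mat n) where
  pos p := {A | (Matrix.comp (Fin p) (Fin p) (Fin n) (Fin n) ℂ A).PosSemidef}
  zero_mem p := Matrix.PosSemidef.zero
  add_mem p A hA B hB := Matrix.PosSemidef.add hA hB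
  smul_mem p r hr A hA := Matrix.PosSemidef.smul hA (Complex.zero_le_real.mpr hr)
  directSum_mem p q A hA B hB := by
    rw [directSum_eq_compress]
    have key : ∀ (m : ℕ) (X : Matrix (Fin m) (Fin (p + q)) ℂ) (D : Matrix (Fin m) (Fin m) (Mat n)),
        (Matrix.comp _ _ _ _ ℂ D).PosSemidef →
        (Matrix.comp _ _ _ _ ℂ (compress X D)).PosSemidef := by
      intro m X D hD
      rw [comp_compress]
      exact hD.conjTranspose_mul_mul_same _
    exact Matrix.PosSemidef.add (key p _ A hA) (key q _ B hB)
  compress_mem p q X A hA := by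
    change Matrix.PosSemidef _
    rw [comp_compress]
    exact Matrix.PosSemidef.conjTranspose_mul_mul_same hA _

/-- The linear map `V → M_p`, `v ↦ (f i j v)`, attached to a `p × p` matrix of functionals. -/
def functionalsMap {V : Type*} [AddCommGroup V] [Module ℂ V] {p : ℕ}
    (f : Matrix (Fin p) (Fin p) (Module.Dual ℂ V)) : V →ₗ[ℂ] Mat p where
  toFun v := Matrix.of fun i j => f i j v
  map_add' v w := by ext i j; simp
  map_smul' c v := by ext i j; simp

theorem functionalsMap_compress {V : Type*} [AddCommGroup V] [Module ℂ V] {p q r : ℕ}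
    (X : Matrix (Fin p) (Fin q) ℂ) (f : Matrix (Fin p) (Fin p) (Module.Dual ℂ V))
    (A : Matrix (Fin r) (Fin r) V) :
    Matrix.comp _ _ _ _ ℂ (A.map (functionalsMap (compress X f))) =
      (Matrix.kronecker (1 : Mat r) X).conjTranspose *
        Matrix.comp _ _ _ _ ℂ (A.map (functionalsMap f)) *
        Matrix.kronecker (1 : Mat r) X := by
  ext ⟨i, a⟩ ⟨j, b⟩
  simp [compress, functionalsMap, Matrix.mul_apply, Fintype.sum_prod_type,
    Matrix.kroneckerMap_apply, Matrix.one_apply, Finset.sum_mul, apply_ite star]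
  rw [Finset.sum_comm]
  refine Finset.sum_congr rfl fun l _ => Finset.sum_congr rfl fun k _ => ?_
  ring

/-- The dual matrix ordering: `(f i j)` in `M_p(V^d)` is positive when the linear map
`V → M_p`, `v ↦ (f i j v)`, is completely positive. -/
def dualOrdering {V : Type*} [AddCommGroup V] [Module ℂ V] (𝒪 : MatrixOrdering V) :
    MatrixOrdering (Module.Dual ℂ V) where
  pos p := {f | IsCompletelyPositive 𝒪 (matOrdering p) (functionalsMap f)}
  zero_mem p := fun r _ _ => (matOrdering p).zero_mem r
  add_mem p f hf g hg := fun r A hA => (matOrdering p).add_mem r _ (hf r A hA) _ (hg r A hA)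
  smul_mem p c hc f hf := fun r A hA => (matOrdering p).smul_mem r c hc _ (hf r A hA)
  directSum_mem p q f hf g hg := by
    intro r A hA
    rw [directSum_eq_compress]
    refine (matOrdering (p + q)).add_mem r (A.map (functionalsMap (compress _ f))) ?_
      (A.map (functionalsMap (compress _ g))) ?_
    · change Matrix.PosSemidef _
      rw [functionalsMap_compress]
      exact Matrix.PosSemidef.conjTranspose_mul_mul_same (hf r A hA) _
    · change Matrix.PosSemidef _
      rw [functionalsMap_compress]
      exact Matrix.PosSemidef.conjTranspose_mul_mul_same (hg r A hA) _
  compress_mem p q X f hf := by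
    intro r A hA
    change Matrix.PosSemidef _
    rw [functionalsMap_compress]
    exact Matrix.PosSemidef.conjTranspose_mul_mul_same (hf r A hA) _

/-- The duality map `D_B : M_n → M_n^d` of a basis `B`, as a linear isomorphism: it takes each
member of `B` to the corresponding member of the dual basis. -/
noncomputable def dualityMap {n : ℕ} {ι : Type*} [Finite ι] [DecidableEq ι]
    (B : Module.Basis ι ℂ (Mat n)) : Mat n ≃ₗ[ℂ] Module.Dual ℂ (Mat n) :=
  B.equiv B.dualBasis (Equiv.refl ι)

/-- `Γ_B = D_B⁻¹ : M_n^d → M_n`. -/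
noncomputable def Gamma {n : ℕ} {ι : Type*} [Finite ι] [DecidableEq ι]
    (B : Module.Basis ι ℂ (Mat n)) : Module.Dual ℂ (Mat n) →ₗ[ℂ] Mat n :=
  (dualityMap B).symm

/-- `L^T`: the linear map on `M_n` whose matrix in the basis `E` of matrix units is the transpose
of the matrix of `L` in that basis. -/
noncomputable def superTranspose {n : ℕ} (L : Mat n →ₗ[ℂ] Mat n) : Mat n →ₗ[ℂ] Mat n :=
  Matrix.toLin (Matrix.stdBasis ℂ (Fin n) (Fin n)) (Matrix.stdBasis ℂ (Fin n) (Fin n))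
    (LinearMap.toMatrix (Matrix.stdBasis ℂ (Fin n) (Fin n))
      (Matrix.stdBasis ℂ (Fin n) (Fin n)) L).transpose

/-- `L` is a change of basis map for `B`: it takes the set of matrix units to the set `B`. -/
def IsChangeOfBasisMap {n : ℕ} {ι : Type*} (B : Module.Basis ι ℂ (Mat n))
    (L : Mat n →ₗ[ℂ] Mat n) : Prop :=
  L '' Set.range (Matrix.stdBasis ℂ (Fin n) (Fin n)) = Set.range B

/-- Every basis of `M_n` has a change of basis map. -/
theorem exists_isChangeOfBasisMap {n : ℕ} {ι : Type*} (B : Module.Basis ι ℂ (Mat n)) :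
    ∃ L : Mat n →ₗ[ℂ] Mat n, IsChangeOfBasisMap B L := by
  let E := Matrix.stdBasis ℂ (Fin n) (Fin n)
  refine ⟨E.equiv B (E.indexEquiv B), ?_⟩
  rw [IsChangeOfBasisMap, ← Set.range_comp, ← (E.indexEquiv B).surjective.range_comp B]
  congr 1
  funext i
  exact E.equiv_apply i B (E.indexEquiv B)

/-- `C_B C_B^T`; for a change of basis map `C_B` of `B` this is `M_B`. -/
noncomputable def MMap {n : ℕ} (CB : Mat n →ₗ[ℂ] Mat n) : Mat n →ₗ[ℂ] Mat n :=
  CB ∘ₗ superTranspose CB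

/-- `Φ_C(X) = C X C*`. -/
def conjMap {n : ℕ} (C : Mat n) : Mat n →ₗ[ℂ] Mat n where
  toFun X := C * X * C.conjTranspose
  map_add' X Y := by rw [mul_add, add_mul]
  map_smul' c X := by simp

/-- The transpose map `t` on `M_n`. -/
def transposeMap (n : ℕ) : Mat n →ₗ[ℂ] Mat n where
  toFun X := X.transpose
  map_add' _ _ := rfl
  map_smul' _ _ := rfl

end DualityMap

namespace DualityMap

/-! Let `U = unitValues n` send `f` to the matrix `(f(E_ij))`. Under `U` the operator `L^T` becomes
precomposition with `L`, which gives `Γ_B = M_B ∘ U` (`Gamma_eq_MMap_comp_unitValues`). By Choi's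
theorem `U` is a complete order isomorphism (`map_unitValues_mem_pos_iff`), so `Γ_B` is one exactly
when `M_B` is one on `M_n`. The complete order automorphisms of `M_n` are the maps `Φ_C` with `C`
invertible (`exists_eq_conjMap_of_isCompleteOrderIso`), and invertibility of `C` is automatic
because `M_B` is injective. The transposed statements follow from `t² = 1` and `M_B^T = M_B`. -/

theorem map_apply_eq_sum_single {n p : ℕ} (L : Mat n →ₗ[ℂ] Mat p) (X : Mat n) (a b : Fin p) :
    L X a b = ∑ k, ∑ l, X k l * L (Matrix.single k l 1) a b := by
  conv_lhs => rw [Matrix.matrix_eq_sum_single X]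
  have h : ∀ k l, Matrix.single k l (X k l) = X k l • Matrix.single k l (1 : ℂ) := by
    intro k l
    simp
  simp only [h, map_sum, map_smul, Matrix.sum_apply, Matrix.smul_apply, smul_eq_mul]

/-- The functional `f` written as the matrix of its values on the matrix units. -/
def unitValues (n : ℕ) : Module.Dual ℂ (Mat n) →ₗ[ℂ] Mat n where
  toFun f := Matrix.of fun i j => f (Matrix.single i j 1)
  map_add' _ _ := by ext; simp
  map_smul' _ _ := by ext; simp

@[simp] theorem unitValues_apply {n : ℕ} (f : Module.Dual ℂ (Mat n)) (i j : Fin n) :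
    unitValues n f i j = f (Matrix.single i j 1) := rfl

theorem unitValues_bijective (n : ℕ) : Function.Bijective (unitValues n) := by
  have hinj : Function.Injective (unitValues n) := by
    intro f g h
    refine (Matrix.stdBasis ℂ (Fin n) (Fin n)).ext fun ⟨i, j⟩ => ?_
    rw [Matrix.stdBasis_eq_single]
    exact congrFun (congrFun h i) j
  refine ⟨hinj, ?_⟩
  rwa [← LinearMap.injective_iff_surjective_of_finrank_eq_finrank]
  exact Subspace.dual_finrank_eq

/-! ### Choi's theorem and Kraus decompositions -/

/-- The Choi matrix of a linear map `M_n → M_p`. -/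
def choi {n p : ℕ} (L : Mat n →ₗ[ℂ] Mat p) : Matrix (Fin n × Fin p) (Fin n × Fin p) ℂ :=
  Matrix.comp _ _ _ _ ℂ (Matrix.of fun k l => L (Matrix.single k l 1))

theorem isCompletelyPositive_of_kraus {n p : ℕ} {κ : Type*} [Fintype κ]
    (L : Mat n →ₗ[ℂ] Mat p) (K : κ → Matrix (Fin p) (Fin n) ℂ)
    (hL : ∀ X, L X = ∑ m, K m * X * (K m).conjTranspose) :
    IsCompletelyPositive (matOrdering n) (matOrdering p) L := by
  intro r A hA
  change Matrix.PosSemidef _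
  have h : Matrix.comp _ _ _ _ ℂ (A.map L) =
      ∑ m, Matrix.kronecker (1 : Mat r) (K m) * Matrix.comp _ _ _ _ ℂ A *
        (Matrix.kronecker (1 : Mat r) (K m)).conjTranspose := by
    ext ⟨i, a⟩ ⟨j, b⟩
    simp [hL, Matrix.sum_apply, Matrix.mul_apply, Fintype.sum_prod_type,
      Matrix.kroneckerMap_apply, Matrix.one_apply, apply_ite star]
  rw [h]
  exact Matrix.posSemidef_sum _ fun m _ => Matrix.PosSemidef.mul_mul_conjTranspose_same hA _

/-- Factor the Choi matrix as `V* V`; the conjugated rows of `V`, reshaped to `p × n`, are the Kraus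
operators. -/
theorem exists_kraus_of_choi_posSemidef {n p : ℕ} (L : Mat n →ₗ[ℂ] Mat p)
    (hL : (choi L).PosSemidef) :
    ∃ K : Fin n × Fin p → Matrix (Fin p) (Fin n) ℂ,
      ∀ X, L X = ∑ m, K m * X * (K m).conjTranspose := by
  open scoped MatrixOrder in
  obtain ⟨V, hV⟩ := CStarAlgebra.nonneg_iff_eq_star_mul_self.mp hL.nonneg
  refine ⟨fun m => Matrix.of fun a k => star (V m (k, a)), fun X => ?_⟩
  ext a b
  have h : ∀ k l, L (Matrix.single k l 1) a b = ∑ m, star (V m (k, a)) * V m (l, b) :=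
    fun k l => (congrFun (congrFun hV (k, a)) (l, b) :)
  simp only [map_apply_eq_sum_single L X, h, Matrix.sum_apply, Matrix.mul_apply, Matrix.of_apply,
    Matrix.conjTranspose_apply, star_star, Finset.sum_mul, Finset.mul_sum]
  rw [Finset.sum_comm]
  simp_rw [Finset.sum_comm (s := (Finset.univ : Finset (Fin n)))
    (t := (Finset.univ : Finset (Fin n × Fin p)))]
  refine Finset.sum_congr rfl fun m _ => Finset.sum_congr rfl fun l _ =>
    Finset.sum_congr rfl fun k _ => ?_
  ring

/-- The block matrix `(E_kl)` is `v v*` for `v = ∑ e_k ⊗ e_k`, hence positive, and `L` applied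
entrywise turns it into the Choi matrix. -/
theorem choi_posSemidef {n p : ℕ} (L : Mat n →ₗ[ℂ] Mat p)
    (hL : IsCompletelyPositive (matOrdering n) (matOrdering p) L) : (choi L).PosSemidef := by
  refine hL n (Matrix.of fun k l => Matrix.single k l 1) ?_
  change Matrix.PosSemidef _
  have h : Matrix.comp _ _ _ _ ℂ (Matrix.of fun k l : Fin n => Matrix.single k l (1 : ℂ)) =
      Matrix.vecMulVec (fun x : Fin n × Fin n => if x.1 = x.2 then (1 : ℂ) else 0)
        (star fun x : Fin n × Fin n => if x.1 = x.2 then (1 : ℂ) else 0) := by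
    ext ⟨i, a⟩ ⟨j, b⟩
    simp [Matrix.vecMulVec_apply, Matrix.single_apply, ite_and, apply_ite star]
    split_ifs <;> rfl
  rw [h]
  exact Matrix.posSemidef_vecMulVec_self_star _

theorem exists_kraus {n p : ℕ} (L : Mat n →ₗ[ℂ] Mat p)
    (hL : IsCompletelyPositive (matOrdering n) (matOrdering p) L) :
    ∃ K : Fin n × Fin p → Matrix (Fin p) (Fin n) ℂ,
      ∀ X, L X = ∑ m, K m * X * (K m).conjTranspose :=
  exists_kraus_of_choi_posSemidef L (choi_posSemidef L hL)

/-- Both sides concern the numbers `f_ij(E_kl)`: the left matrix is the Choi matrix of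
`functionalsMap f` with its two tensor factors swapped. -/
theorem map_unitValues_mem_pos_iff {n p : ℕ} (f : Matrix (Fin p) (Fin p) (Module.Dual ℂ (Mat n))) :
    f.map (unitValues n) ∈ (matOrdering n).pos p ↔ f ∈ (dualOrdering (matOrdering n)).pos p := by
  have h : (f.map (unitValues n) ∈ (matOrdering n).pos p) ↔
      (choi (functionalsMap f)).PosSemidef :=
    (Matrix.posSemidef_submatrix_equiv (M := choi (functionalsMap f))
      (Equiv.prodComm (Fin p) (Fin n)))
  rw [h]
  constructor
  · intro hf
    obtain ⟨K, hK⟩ := exists_kraus_of_choi_posSemidef _ hf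
    exact isCompletelyPositive_of_kraus _ K hK
  · exact choi_posSemidef _

/-! ### Complete order automorphisms of `M_n` -/

/-- For `w ⊥ v`, evaluating at `X = v v*` and pairing with `w` gives `∑ |⟨w, D_m v⟩|² = 0`, so every
term vanishes. -/
theorem eq_smul_one_of_sum_conj_eq {n : ℕ} {κ : Type*} [Fintype κ] (D : κ → Mat n)
    (hD : ∀ X, ∑ m, D m * X * (D m).conjTranspose = X) (m : κ) : ∃ c : ℂ, D m = c • 1 := by
  have key : ∀ v w : Fin n → ℂ, star w ⬝ᵥ v = 0 → star w ⬝ᵥ (D m).mulVec v = 0 := by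
    intro v w hvw
    have h1 : ∀ m', star w ⬝ᵥ (D m' * Matrix.vecMulVec v (star v) *
        (D m').conjTranspose).mulVec w =
        (star w ⬝ᵥ (D m').mulVec v) * star (star w ⬝ᵥ (D m').mulVec v) := by
      intro m'
      rw [Matrix.mul_vecMulVec, Matrix.vecMulVec_mul, Matrix.vecMulVec_mulVec,
        ← Matrix.star_mulVec, ← Matrix.star_dotProduct]
      simp [mul_comm]
    have h2 := congrArg (fun Y : Mat n => star w ⬝ᵥ Y.mulVec w) (hD (Matrix.vecMulVec v (star v)))
    simp only [Matrix.sum_mulVec, dotProduct_sum, h1] at h2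
    rw [Matrix.vecMulVec_mulVec] at h2
    simp only [dotProduct_smul, hvw, smul_zero] at h2
    have h3 := (Finset.sum_eq_zero_iff_of_nonneg
      (fun i _ => mul_star_self_nonneg (star w ⬝ᵥ (D i).mulVec v))).mp h2 m (Finset.mem_univ _)
    simpa using h3
  have hoff : ∀ i j, i ≠ j → D m i j = 0 := by
    intro i j hij
    have := key (Pi.single j 1) (Pi.single i 1) (by simp [hij])
    simpa using this
  have hdiag : ∀ i j, D m i i = D m j j := by
    intro i j
    by_cases hij : i = j
    · rw [hij]
    -- The orthogonal pair `e_i + e_j`, `e_i - e_j` compares the two diagonal entries.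
    have := key (Pi.single i 1 + Pi.single j 1) (Pi.single i 1 - Pi.single j 1)
      (by simp [hij, Ne.symm hij, dotProduct_add])
    simp [sub_dotProduct, Matrix.mulVec_add, hoff i j hij, hoff j i (Ne.symm hij)] at this
    exact sub_eq_zero.mp this
  rcases isEmpty_or_nonempty (Fin n) with _ | ⟨⟨i₀⟩⟩
  · exact ⟨0, Subsingleton.elim _ _⟩
  · refine ⟨D m i₀ i₀, ?_⟩
    ext i j
    by_cases hij : i = j
    · subst hij
      simp [hdiag i i₀]
    · simp [hoff i j hij, hij]

theorem isCompletelyPositive_conjMap {n : ℕ} (C : Mat n) :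
    IsCompletelyPositive (matOrdering n) (matOrdering n) (conjMap C) :=
  isCompletelyPositive_of_kraus (κ := Unit) _ (fun _ => C) fun X => by simp [conjMap]

/-- If `C v = 0`, then `Φ_C` kills `v v*`, so `v = 0`. -/
theorem isUnit_of_injective_conjMap {n : ℕ} {C : Mat n}
    (hC : Function.Injective (conjMap C)) : IsUnit C := by
  rw [← Matrix.mulVec_injective_iff_isUnit]
  rw [← Matrix.coe_mulVecLin, ← LinearMap.ker_eq_bot, LinearMap.ker_eq_bot']
  intro v hv
  have h : conjMap C (Matrix.vecMulVec v (star v)) = conjMap C 0 := by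
    rw [map_zero]
    change C * _ * _ = 0
    rw [Matrix.mul_vecMulVec, show C.mulVec v = 0 from hv]
    simp
  simpa using hC h

theorem isCompleteOrderIso_conjMap {n : ℕ} {C : Mat n}
    (hC : Function.Injective (conjMap C)) :
    IsCompleteOrderIso (matOrdering n) (matOrdering n) (conjMap C) := by
  obtain ⟨u, rfl⟩ := isUnit_of_injective_conjMap hC
  have h : ∀ u : (Mat n)ˣ, conjMap (↑u⁻¹ : Mat n) ∘ₗ conjMap (u : Mat n) = LinearMap.id := by
    intro u
    have h2 : (u : Mat n).conjTranspose * (↑u⁻¹ : Mat n).conjTranspose = 1 := by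
      rw [← Matrix.conjTranspose_mul, Units.inv_mul, Matrix.conjTranspose_one]
    ext1 X
    change (↑u⁻¹ : Mat n) * (u * X * (u : Mat n).conjTranspose) * (↑u⁻¹ : Mat n).conjTranspose = X
    rw [mul_assoc, mul_assoc _ _ (Matrix.conjTranspose _), h2, mul_one, ← mul_assoc,
      Units.inv_mul, one_mul]
  exact ⟨conjMap (↑u⁻¹ : Mat n), h u, by simpa using h u⁻¹, isCompletelyPositive_conjMap _,
    isCompletelyPositive_conjMap _⟩

/-- With Kraus operators `A_k` of `L` and `R_l` of its inverse, the products `R_l A_k` are Kraus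
operators of the identity, hence scalars. A nonzero one makes `A_k` invertible and every other
`A_k'` a multiple of it, so the Kraus sum collapses to one term. -/
theorem exists_eq_conjMap_of_isCompleteOrderIso {n : ℕ} {L : Mat n →ₗ[ℂ] Mat n}
    (hL : IsCompleteOrderIso (matOrdering n) (matOrdering n) L) : ∃ C, L = conjMap C := by
  rcases isEmpty_or_nonempty (Fin n) with _ | _
  · exact ⟨0, LinearMap.ext fun X => Subsingleton.elim _ _⟩
  obtain ⟨Ψ, hΨL, -, hLpos, hΨpos⟩ := hL
  obtain ⟨A, hA⟩ := exists_kraus L hLpos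
  obtain ⟨R, hR⟩ := exists_kraus Ψ hΨpos
  have hsum : ∀ X, ∑ m : (Fin n × Fin n) × (Fin n × Fin n),
      (R m.1 * A m.2) * X * (R m.1 * A m.2).conjTranspose = X := by
    intro X
    conv_rhs => rw [← LinearMap.id_apply (R := ℂ) X, ← hΨL, LinearMap.comp_apply, hR, hA]
    simp only [Fintype.sum_prod_type (α₁ := Fin n × Fin n), Finset.mul_sum, Finset.sum_mul,
      Matrix.conjTranspose_mul, mul_assoc]
  have hscal : ∀ l k, ∃ c : ℂ, R l * A k = c • 1 := fun l k =>
    eq_smul_one_of_sum_conj_eq _ hsum (l, k)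
  choose c hc using hscal
  obtain ⟨l, k, hlk⟩ : ∃ l k, c l k ≠ 0 := by
    by_contra! h
    have := hsum 1
    simp [hc, h] at this
  have hAR : A k * R l = c l k • 1 := by
    have h1 : ((c l k)⁻¹ • R l) * A k = 1 := by
      rw [smul_mul_assoc, hc, smul_smul, inv_mul_cancel₀ hlk, one_smul]
    have h2 := mul_eq_one_comm.mp h1
    rw [mul_smul_comm] at h2
    rw [← h2, smul_smul, mul_inv_cancel₀ hlk, one_smul]
  have hAk : ∀ k', A k' = (c l k' / c l k) • A k := by
    intro k'
    have h1 : A k * R l * A k' = c l k' • A k := by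
      rw [mul_assoc, hc, mul_smul_comm, mul_one]
    rw [hAR, smul_mul_assoc, one_mul] at h1
    rw [div_eq_inv_mul, ← smul_smul, ← h1, smul_smul, inv_mul_cancel₀ hlk, one_smul]
  set s : ℝ := ∑ k', Complex.normSq (c l k' / c l k) with hs
  have hs0 : 0 ≤ s := Finset.sum_nonneg fun _ _ => Complex.normSq_nonneg _
  -- The sum equals `s • A_k X A_k*`; the factor `√s` enters twice in `Φ_C`.
  refine ⟨((√s : ℝ) : ℂ) • A k, LinearMap.ext fun X => ?_⟩
  have h1 : ∀ k', A k' * X * (A k').conjTranspose =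
      ((Complex.normSq (c l k' / c l k) : ℝ) : ℂ) • (A k * X * (A k).conjTranspose) := by
    intro k'
    rw [hAk k', Matrix.conjTranspose_smul, smul_mul_assoc, smul_mul_assoc, mul_smul_comm,
      smul_smul, ← Complex.mul_conj]
    rfl
  rw [hA, Finset.sum_congr rfl fun k' _ => h1 k']
  rw [← Finset.sum_smul, ← Complex.ofReal_sum, ← hs]
  change _ = _ * X * _
  rw [Matrix.conjTranspose_smul, smul_mul_assoc, smul_mul_assoc, mul_smul_comm, smul_smul]
  congr 1
  change _ = ((√s : ℝ) : ℂ) * (starRingEnd ℂ) ((√s : ℝ) : ℂ)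
  rw [Complex.conj_ofReal, ← Complex.ofReal_mul, Real.mul_self_sqrt hs0]

theorem isCompleteOrderIso_comp_unitValues_iff {n : ℕ} (L : Mat n →ₗ[ℂ] Mat n) :
    IsCompleteOrderIso (dualOrdering (matOrdering n)) (matOrdering n) (L ∘ₗ unitValues n) ↔
      IsCompleteOrderIso (matOrdering n) (matOrdering n) L := by
  let U := LinearEquiv.ofBijective (unitValues n) (unitValues_bijective n)
  have hU : ∀ x, unitValues n (U.symm x) = x := U.apply_symm_apply
  have hU' : ∀ f, U.symm (unitValues n f) = f := U.symm_apply_apply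
  constructor
  · rintro ⟨Ψ, h1, h2, h3, h4⟩
    refine ⟨unitValues n ∘ₗ Ψ, ?_, ?_, ?_, ?_⟩
    · ext1 X
      have := LinearMap.congr_fun h1 (U.symm X)
      simp only [LinearMap.comp_apply, hU, LinearMap.id_apply] at this ⊢
      rw [this, hU]
    · exact h2
    · intro p A hA
      have := h3 p (A.map U.symm) ((map_unitValues_mem_pos_iff _).mp (by
        simpa [Matrix.map_map, Function.comp_def, hU] using hA))
      simpa [Matrix.map_map, Function.comp_def, hU] using this
    · intro p A hA
      have := (map_unitValues_mem_pos_iff _).mpr (h4 p A hA)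
      simpa [Matrix.map_map, Function.comp_def] using this
  · rintro ⟨Ψ, h1, h2, h3, h4⟩
    refine ⟨U.symm.toLinearMap ∘ₗ Ψ, ?_, ?_, ?_, ?_⟩
    · ext1 f
      have := LinearMap.congr_fun h1 (unitValues n f)
      simp only [LinearMap.comp_apply, LinearMap.id_apply, LinearEquiv.coe_coe] at this ⊢
      rw [this, hU']
    · ext1 X
      have := LinearMap.congr_fun h2 X
      simpa only [LinearMap.comp_apply, LinearMap.id_apply, LinearEquiv.coe_coe, hU] using this
    · intro p f hf
      have := h3 p _ ((map_unitValues_mem_pos_iff _).mpr hf)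
      simpa [Matrix.map_map, Function.comp_def] using this
    · intro p A hA
      refine (map_unitValues_mem_pos_iff _).mp ?_
      have := h4 p A hA
      simpa [Matrix.map_map, Function.comp_def, hU] using this

/-! ### Factoring `Γ_B` through `M_B` -/

theorem superTranspose_unitValues {n : ℕ} (L : Mat n →ₗ[ℂ] Mat n) (f : Module.Dual ℂ (Mat n)) :
    superTranspose L (unitValues n f) = unitValues n (f ∘ₗ L) := by
  let E := Matrix.stdBasis ℂ (Fin n) (Fin n)
  have hrepr : ∀ (X : Mat n) (x : Fin n × Fin n), E.repr X x = X x.1 x.2 := fun X x => rfl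
  apply E.repr.injective
  ext x
  have h1 : E.repr (superTranspose L (unitValues n f)) x =
      ∑ y, E.repr (L (E x)) y * f (E y) := by
    rw [superTranspose, Matrix.toLin_apply, E.repr_sum_self]
    refine Finset.sum_congr rfl fun y _ => ?_
    change LinearMap.toMatrix E E L y x * E.repr (unitValues n f) y = _
    rw [LinearMap.toMatrix_apply, hrepr (unitValues n f), unitValues_apply,
      ← Matrix.stdBasis_eq_single]
  rw [h1, hrepr, unitValues_apply, ← Matrix.stdBasis_eq_single]
  conv_rhs => rw [LinearMap.comp_apply, ← E.sum_repr (L _)]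
  rw [map_sum]
  simp only [map_smul, smul_eq_mul]
  rfl

theorem superTranspose_superTranspose {n : ℕ} (L : Mat n →ₗ[ℂ] Mat n) :
    superTranspose (superTranspose L) = L := by
  simp [superTranspose]

theorem superTranspose_comp {n : ℕ} (L K : Mat n →ₗ[ℂ] Mat n) :
    superTranspose (L ∘ₗ K) = superTranspose K ∘ₗ superTranspose L := by
  let E := Matrix.stdBasis ℂ (Fin n) (Fin n)
  simp only [superTranspose]
  rw [LinearMap.toMatrix_comp E E E, Matrix.transpose_mul, Matrix.toLin_mul E E E]

theorem superTranspose_MMap {n : ℕ} (L : Mat n →ₗ[ℂ] Mat n) :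
    superTranspose (MMap L) = MMap L := by
  rw [MMap, superTranspose_comp, superTranspose_superTranspose]

/-- If `C_B` sends the matrix unit `x` to `b_i`, then `b_i^* ∘ C_B` is the coordinate functional of
`x`. So `C_B^T U(b_i^*) = x`, and `C_B` takes this to `b_i = Γ_B(b_i^*)`. -/
theorem Gamma_eq_MMap_comp_unitValues {n : ℕ} {ι : Type*} [Finite ι] [DecidableEq ι]
    (B : Module.Basis ι ℂ (Mat n)) (CB : Mat n →ₗ[ℂ] Mat n) (hCB : IsChangeOfBasisMap B CB) :
    Gamma B = MMap CB ∘ₗ unitValues n := by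
  let E := Matrix.stdBasis ℂ (Fin n) (Fin n)
  -- The range contains a basis; finite dimension then yields injectivity, needed to identify matrix
  -- units from their images.
  have hsurj : Function.Surjective CB := by
    rw [← LinearMap.range_eq_top, eq_top_iff, ← B.span_eq, Submodule.span_le, ← hCB]
    exact Set.image_subset_range _ _
  have hinj : Function.Injective CB := LinearMap.injective_iff_surjective.mpr hsurj
  refine B.dualBasis.ext fun i => ?_
  have hG : Gamma B (B.dualBasis i) = B i := by
    rw [Gamma, LinearEquiv.coe_coe, LinearEquiv.symm_apply_eq, dualityMap,
      Module.Basis.equiv_apply, Equiv.refl_apply]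
  obtain ⟨_, ⟨x, rfl⟩, hx⟩ : B i ∈ CB '' Set.range E := hCB ▸ Set.mem_range_self i
  have hU : unitValues n (B.dualBasis i ∘ₗ CB) = E x := by
    obtain ⟨k, l⟩ := x
    ext a b
    obtain ⟨j, hj⟩ : CB (E (a, b)) ∈ Set.range B := hCB ▸ ⟨_, Set.mem_range_self _, rfl⟩
    have hij : j = i ↔ (k = a ∧ l = b) := by
      rw [← B.injective.eq_iff, hj, ← hx, hinj.eq_iff, E.injective.eq_iff, Prod.mk.injEq, eq_comm,
        @eq_comm _ b]
    rw [unitValues_apply, ← Matrix.stdBasis_eq_single, LinearMap.comp_apply, ← hj,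
      Matrix.stdBasis_eq_single, Matrix.single_apply, Module.Basis.dualBasis_apply_self]
    simp [hij]
  rw [hG, LinearMap.comp_apply, MMap, LinearMap.comp_apply, superTranspose_unitValues, hU, hx]

theorem exists_eq_conjMap_iff {n : ℕ} {L : Mat n →ₗ[ℂ] Mat n} (hL : Function.Injective L) :
    (∃ C, L = conjMap C) ↔
      IsCompleteOrderIso (dualOrdering (matOrdering n)) (matOrdering n) (L ∘ₗ unitValues n) := by
  rw [isCompleteOrderIso_comp_unitValues_iff]
  constructor
  · rintro ⟨C, rfl⟩
    exact isCompleteOrderIso_conjMap hL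
  · exact exists_eq_conjMap_of_isCompleteOrderIso

theorem eq_transposeMap_comp_iff {n : ℕ} (L K : Mat n →ₗ[ℂ] Mat n) :
    L = transposeMap n ∘ₗ K ↔ transposeMap n ∘ₗ L = K := by
  constructor <;> rintro rfl <;> rfl

end DualityMap

theorem mainTheorem10 {n : ℕ} {ι : Type*} [Finite ι] [DecidableEq ι]
    (B : Module.Basis ι ℂ (DualityMap.Mat n))
    (CB : DualityMap.Mat n →ₗ[ℂ] DualityMap.Mat n) (hCB : DualityMap.IsChangeOfBasisMap B CB) :
    ((∃ C : DualityMap.Mat n, DualityMap.MMap CB = DualityMap.conjMap C) ↔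
      DualityMap.IsCompleteOrderIso (DualityMap.dualOrdering (DualityMap.matOrdering n))
        (DualityMap.matOrdering n) (DualityMap.Gamma B)) ∧
    ((∃ C : DualityMap.Mat n,
        DualityMap.MMap CB = DualityMap.transposeMap n ∘ₗ DualityMap.conjMap C) ↔
      DualityMap.IsCompleteOrderIso (DualityMap.dualOrdering (DualityMap.matOrdering n))
        (DualityMap.matOrdering n) (DualityMap.transposeMap n ∘ₗ DualityMap.Gamma B)) ∧
    ((∃ C : DualityMap.Mat n, DualityMap.superTranspose (DualityMap.MMap CB) =
        DualityMap.transposeMap n ∘ₗ DualityMap.conjMap C) ↔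
      DualityMap.IsCompleteOrderIso (DualityMap.dualOrdering (DualityMap.matOrdering n))
        (DualityMap.matOrdering n) (DualityMap.transposeMap n ∘ₗ DualityMap.Gamma B)) := by
  have hΓ := DualityMap.Gamma_eq_MMap_comp_unitValues B CB hCB
  have hinj : Function.Injective (DualityMap.MMap CB) := by
    have h : Function.Injective (DualityMap.MMap CB ∘ DualityMap.unitValues n) := by
      rw [← LinearMap.coe_comp, ← hΓ]
      exact (DualityMap.dualityMap B).symm.injective
    exact h.of_comp_right (DualityMap.unitValues_bijective n).surjective
  have hinj' : Function.Injective (DualityMap.transposeMap n ∘ₗ DualityMap.MMap CB) :=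
    Matrix.transpose_injective.comp hinj
  rw [DualityMap.superTranspose_MMap, hΓ]
  simp only [DualityMap.eq_transposeMap_comp_iff]
  rw [← LinearMap.comp_assoc]
  exact ⟨DualityMap.exists_eq_conjMap_iff hinj, DualityMap.exists_eq_conjMap_iff hinj',
    DualityMap.exists_eq_conjMap_iff hinj'⟩
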